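/- All graphs are finite and simple. A colouring of a graph has defect $d$ (respectively, clustering $c$) if every monochromatic component, i.e. every connected component of the subgraph induced by the vertices of one colour, has maximum degree at most $d$ (respectively, has at most $c$ vertices). For a class $\mathcal{G}$ of graphs, closed under isomorphism, the chromatic number of $\mathcal{G}$ is the maximum chromatic number of a graph in $\mathcal{G}$; the defective (respectively, clustered) chromatic number of $\mathcal{G}$ is the minimum integer $m$ for which there is an integer $d$ (respectively, $c$) such that every graph in $\mathcal{G}$ has a colouring with at most $m$ colours with defect $d$ (respectively, with clustering $c$). The treedepth of a graph $G$ is the minimum, over all rooted forests $F$ with vertex set $V(G)$ such that the two ends of each edge of $G$ are in the ancestor–descendant relation of $F$, of the maximum number of vertices in a path of $F$ from a vertex to its root. There is a function $\varepsilon:\mathbb{N}\to\mathbb{R}$ with $\varepsilon(k)\to 0$ as $k\to\infty$ such that the following holds for every integer $k\geq 1$. For the class of triangle-free graphs with treedepth $k$, the chromatic number, the defective chromatic number and the clustered chromatic number are finite and equal, and their common value $c_k$ satisfies $$(1-\varepsilon(k))\sqrt{2k}\;\leq\; c_k\;\leq\;\left\lceil\frac{k+2}{2}\right\rceil.$$ Moreover,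 for the class of triangle-free graphs with treedepth at most $k$, the same three numbers are also all equal to $c_k$. -/

import Mathlib

/-! ### Improper colourings -/

/-- A monochromatic component of `G` under the colouring `col`: a connected component of the
subgraph induced by the vertices of one colour `i`. -/
abbrev MonoComponent {V : Type} {k : ℕ} (G : SimpleGraph V) (col : V → Fin k) (i : Fin k) : Type :=
  (G.induce {v | col v = i}).ConnectedComponent

/-- Every monochromatic component has maximum degree at most `d`. -/
def HasDefect {V : Type} {k : ℕ} (G : SimpleGraph V) (col : V → Fin k) (d : ℕ) : Prop :=
  ∀ (i : Fin k) (C : MonoComponent G col i) (v : C), (C.toSimpleGraph.neighborSet v).ncard ≤ d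

/-- Every monochromatic component has at most `c` vertices. -/
def HasClustering {V : Type} {k : ℕ} (G : SimpleGraph V) (col : V → Fin k) (c : ℕ) : Prop :=
  ∀ (i : Fin k) (C : MonoComponent G col i), C.supp.ncard ≤ c

/-! ### Graph classes and their chromatic numbers -/

/-- A class of finite simple graphs, closed under isomorphism. -/
structure GraphClass where
  /-- Membership of a finite graph in the class. -/
  Mem : ∀ {V : Type} [Finite V], SimpleGraph V → Prop
  iso : ∀ {V W : Type} [Finite V] [Finite W] {G : SimpleGraph V} {H : SimpleGraph W},
    (G ≃g H) → Mem G → Mem H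

namespace GraphClass

/-- The maximum chromatic number of a graph in the class, with value `⊤` if unbounded. -/
noncomputable def chromaticNumber (𝒢 : GraphClass) : ℕ∞ :=
  sSup {n : ℕ∞ | ∃ (V : Type) (_ : Finite V) (G : SimpleGraph V), 𝒢.Mem G ∧ n = G.chromaticNumber}

/-- The least `k` such that, for some `d`, every graph in the class is `k`-colourable with
defect `d`; the value is `⊤` if there is no such `k`. -/
noncomputable def defectiveChromaticNumber (𝒢 : GraphClass) : ℕ∞ :=
  sInf {n : ℕ∞ | ∃ k : ℕ, n = k ∧ ∃ d : ℕ, ∀ (V : Type) [Finite V] (G : SimpleGraph V),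
    𝒢.Mem G → ∃ col : V → Fin k, HasDefect G col d}

/-- The least `k` such that, for some `c`, every graph in the class is `k`-colourable with
clustering `c`; the value is `⊤` if there is no such `k`. -/
noncomputable def clusteredChromaticNumber (𝒢 : GraphClass) : ℕ∞ :=
  sInf {n : ℕ∞ | ∃ k : ℕ, n = k ∧ ∃ c : ℕ, ∀ (V : Type) [Finite V] (G : SimpleGraph V),
    𝒢.Mem G → ∃ col : V → Fin k, HasClustering G col c}

end GraphClass

/-! ### Treedepth -/

/-- A rooted forest with vertex set `V`, given by its parent function; the roots are the vertices
without a parent. On a finite vertex set, acyclicity says that following parents from any vertex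
ends at a root. -/
structure RootedForest (V : Type) where
  /-- The parent of a vertex, `none` at a root. -/
  parent : V → Option V
  acyclic : ∀ v, ¬ Relation.TransGen (fun x y => parent y = some x) v v

namespace RootedForest

variable {V W : Type}

/-- `u` is an ancestor of `v`: it is distinct from `v` and lies on the path from `v` to its root. -/
def IsAncestor (F : RootedForest V) (u v : V) : Prop :=
  Relation.TransGen (fun x y => F.parent y = some x) u v

/-- The number of vertices in the path from `v` to its root. -/
noncomputable def depthOf (F : RootedForest V) (v : V) : ℕ :=
  {u | u = v ∨ F.IsAncestor u v}.ncard

/-- The maximum depth of a vertex (on a finite vertex set; `0` for the empty forest). -/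
noncomputable def depth (F : RootedForest V) : ℕ :=
  ⨆ v, F.depthOf v

/-- The closure of a rooted forest joins every vertex to all of its ancestors. -/
def closure (F : RootedForest V) : SimpleGraph V where
  Adj v w := F.IsAncestor v w ∨ F.IsAncestor w v
  symm := ⟨fun _ _ h => h.symm⟩
  loopless := ⟨fun v h => h.elim (F.acyclic v) (F.acyclic v)⟩

/-- Transport of a rooted forest along a bijection of vertex sets. -/
def mapEquiv (F : RootedForest V) (e : V ≃ W) : RootedForest W where
  parent w := (F.parent (e.symm w)).map e
  acyclic w h := F.acyclic (e.symm w) <| h.lift e.symm fun x y hxy => by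
    obtain ⟨z, hz, rfl⟩ := Option.map_eq_some_iff.1 hxy
    simpa [Function.onFun] using hz

theorem isAncestor_mapEquiv (F : RootedForest V) (e : V ≃ W) (u v : W) :
    (F.mapEquiv e).IsAncestor u v ↔ F.IsAncestor (e.symm u) (e.symm v) := by
  constructor
  · intro h
    refine h.lift e.symm fun x y hxy => ?_
    obtain ⟨z, hz, rfl⟩ := Option.map_eq_some_iff.1 hxy
    simpa [Function.onFun] using hz
  · intro h
    have := h.lift (p := fun x y => (F.mapEquiv e).parent y = some x) e fun x y hxy => by
      simp [Function.onFun, mapEquiv, hxy]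
    simpa [IsAncestor, Function.onFun] using this

theorem depth_mapEquiv (F : RootedForest V) (e : V ≃ W) : (F.mapEquiv e).depth = F.depth := by
  have key : ∀ w, (F.mapEquiv e).depthOf w = F.depthOf (e.symm w) := by
    intro w
    unfold depthOf
    rw [← Set.ncard_image_of_injective _ e.symm.injective]
    congr 1
    ext x
    simp only [Set.mem_image, Set.mem_ofPred_eq, isAncestor_mapEquiv]
    constructor
    · rintro ⟨u, rfl | hu, rfl⟩
      · exact Or.inl rfl
      · exact Or.inr hu
    · rintro (rfl | hx)
      · exact ⟨w, Or.inl rfl, rfl⟩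
      · exact ⟨e x, Or.inr (by simpa using hx), by simp⟩
  unfold depth
  simp only [key]
  exact e.symm.iSup_congr fun _ => rfl

end RootedForest

/-- The minimum depth of a rooted forest on the vertex set of `G` whose closure contains `G` (such
a forest exists whenever `G` is finite). -/
noncomputable def treedepth {V : Type} (G : SimpleGraph V) : ℕ :=
  sInf {n : ℕ | ∃ F : RootedForest V, G ≤ F.closure ∧ F.depth = n}

theorem treedepth_congr {V W : Type} {G : SimpleGraph V} {H : SimpleGraph W} (e : G ≃g H) :
    treedepth G = treedepth H := by
  have key : ∀ {V W : Type} {G : SimpleGraph V} {H : SimpleGraph W} (_ : G ≃g H) (n : ℕ),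
      (∃ F : RootedForest V, G ≤ F.closure ∧ F.depth = n) →
        ∃ F : RootedForest W, H ≤ F.closure ∧ F.depth = n := by
    rintro V W G H e n ⟨F, hF, rfl⟩
    refine ⟨F.mapEquiv e.toEquiv, fun u v huv => ?_, F.depth_mapEquiv _⟩
    have h := hF (e.symm.map_adj_iff.2 huv)
    exact h.imp (F.isAncestor_mapEquiv _ _ _).2 (F.isAncestor_mapEquiv _ _ _).2
  unfold treedepth
  congr 1
  ext n
  exact ⟨key e n, key e.symm n⟩

/-! ### The classes in question -/

/-- The class of triangle-free graphs with treedepth (exactly) `k`. -/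
def triangleFreeTreedepth (k : ℕ) : GraphClass where
  Mem G := G.CliqueFree 3 ∧ treedepth G = k
  iso e h := ⟨h.1.comap e.symm.toEmbedding.isContained, (treedepth_congr e).symm.trans h.2⟩

/-- The class of triangle-free graphs with treedepth at most `k`. -/
def triangleFreeTreedepthLE (k : ℕ) : GraphClass where
  Mem G := G.CliqueFree 3 ∧ treedepth G ≤ k
  iso e h := ⟨h.1.comap e.symm.toEmbedding.isContained, (treedepth_congr e).symm.trans_le h.2⟩

/-!
A graph has treedepth at most `k` exactly if it is a subgraph of the comparability graph of a
partial order in which the elements below any given one form a chain of at most `k` elements.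

For the upper bound, colour first-fit from the bottom up. If `v` receives the colour `c > 0`, it
has `c` lower neighbours, and one of them, `z`, has the colour `c - 1`, hence `c - 1` lower
neighbours of its own. In a triangle-free graph the two neighbourhoods are disjoint, so at least
`2 * c - 1` elements lie strictly below `v`, and `2 * c ≤ k`.

For the lower bound, an adversary presents vertices one at a time, and a tree of depth `k` encodes
all its strategies of `k` moves. Joining each new vertex only to an independent set of earlier
ones keeps the graph triangle-free, and `l + 1` moves suffice to turn `l` independent vertices of
distinct colours into `l + 1` such vertices. Hence `1 + 2 + ⋯ + l` moves force `l` colours.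

The defective chromatic number is no smaller, because a graph of treedepth at most `k` has a
blow-up of the same treedepth, any colouring of which with small defect contains a proper
colouring of the original graph. Adding `K_{n, n+1}`, of treedepth `n + 1`, as a component makes
the treedepth exact.
-/

section TriangleFree

variable {V W : Type*} {G : SimpleGraph V} {H : SimpleGraph W}

theorem cliqueFree_three_iff :
    G.CliqueFree 3 ↔ ∀ ⦃a b c⦄, G.Adj a b → G.Adj b c → ¬ G.Adj a c := by
  classical
  refine ⟨fun h a b c hab hbc hac => h {a, b, c} ?_, fun h s hs => ?_⟩
  · exact SimpleGraph.is3Clique_triple_iff.2 ⟨hab, hac, hbc⟩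
  · obtain ⟨a, b, c, hab, hac, hbc, -⟩ := SimpleGraph.is3Clique_iff.1 hs
    exact h hab hbc hac

theorem cliqueFree_three_of_hom (f : G →g H) (h : H.CliqueFree 3) : G.CliqueFree 3 := by
  rw [cliqueFree_three_iff] at h ⊢
  exact fun a b c hab hbc hac => h (f.map_adj hab) (f.map_adj hbc) (f.map_adj hac)

theorem cliqueFree_three_sum (hG : G.CliqueFree 3) (hH : H.CliqueFree 3) :
    (G ⊕g H).CliqueFree 3 := by
  rw [cliqueFree_three_iff] at hG hH ⊢
  rintro (a | a) (b | b) (c | c) hab hbc hac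
  all_goals first | exact hG hab hbc hac | exact hH hab hbc hac | simp at hab hbc hac

end TriangleFree

/-! ### Forest orders -/

section ForestOrder

/-- The comparability graph of a partial order: distinct comparable elements are adjacent. -/
def comparabilityGraph (V : Type*) [PartialOrder V] : SimpleGraph V where
  Adj u v := u < v ∨ v < u
  symm := ⟨fun _ _ h => h.symm⟩
  loopless := ⟨fun v h => h.elim (lt_irrefl v) (lt_irrefl v)⟩

/-- The ancestor orders of the rooted forests of depth at most `k`: the elements below any given
one form a chain of at most `k` elements. -/
structure IsForestOrder (V : Type*) [PartialOrder V] (k : ℕ) : Prop where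
  isChain_Iic : ∀ v : V, IsChain (· ≤ ·) (Set.Iic v)
  encard_Iic_le : ∀ v : V, (Set.Iic v).encard ≤ k

theorem isForestOrder_natCard (V : Type*) [LinearOrder V] [Finite V] :
    IsForestOrder V (Nat.card V) where
  isChain_Iic _ _ _ _ _ _ := le_total _ _
  encard_Iic_le v := by
    rw [← ENat.card_eq_coe_natCard]
    exact Set.encard_le_card

theorem IsForestOrder.of_orderEmbedding {V W : Type*} [PartialOrder V] [PartialOrder W] {k : ℕ}
    (hW : IsForestOrder W k) (f : V ↪o W) : IsForestOrder V k where
  isChain_Iic v x hx y hy _ := by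
    simpa only [f.le_iff_le] using (hW.isChain_Iic (f v)).total (f.monotone hx) (f.monotone hy)
  encard_Iic_le v :=
    have hf : Set.MapsTo f (Set.Iic v) (Set.Iic (f v)) := fun _ hx => f.monotone hx
    (Set.encard_le_encard_of_injOn hf f.injective.injOn).trans (hW.encard_Iic_le (f v))

theorem IsForestOrder.sum {V W : Type*} [PartialOrder V] [PartialOrder W] {k : ℕ}
    (hV : IsForestOrder V k) (hW : IsForestOrder W k) : IsForestOrder (V ⊕ W) k := by
  have Iic_inl (v : V) : Set.Iic (Sum.inl v : V ⊕ W) = Sum.inl '' Set.Iic v := by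
    ext (x | x) <;> simp
  have Iic_inr (w : W) : Set.Iic (Sum.inr w : V ⊕ W) = Sum.inr '' Set.Iic w := by
    ext (x | x) <;> simp
  constructor
  · rintro (v | w)
    · rw [Iic_inl]
      exact (hV.isChain_Iic v).image_of_map_rel _ _ _ Sum.inl_mono
    · rw [Iic_inr]
      exact (hW.isChain_Iic w).image_of_map_rel _ _ _ Sum.inr_mono
  · rintro (v | w)
    · rw [Iic_inl]
      exact (Set.encard_image_le _ _).trans (hV.encard_Iic_le v)
    · rw [Iic_inr]
      exact (Set.encard_image_le _ _).trans (hW.encard_Iic_le w)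

end ForestOrder

namespace RootedForest

variable {V : Type}

theorem isAncestor_total (F : RootedForest V) {u v w : V} (hu : F.IsAncestor u w)
    (hv : F.IsAncestor v w) : u = v ∨ F.IsAncestor u v ∨ F.IsAncestor v u := by
  have hfun : Relator.RightUnique fun y x => F.parent y = some x := fun _ _ _ h h' =>
    Option.some_injective _ (h.symm.trans h')
  have hu' := (Relation.transGen_swap.1 hu).to_reflTransGen
  have hv' := (Relation.transGen_swap.1 hv).to_reflTransGen
  rcases Relation.ReflTransGen.total_of_right_unique hfun hu' hv' with h | h <;>
    rcases Relation.reflTransGen_iff_eq_or_transGen.1 h with h | h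
  exacts [.inl h.symm, .inr (.inr (Relation.transGen_swap.1 h)), .inl h,
    .inr (.inl (Relation.transGen_swap.1 h))]

/-- The ancestor order of a rooted forest, with the roots as minimal elements. -/
abbrev ancestorOrder (F : RootedForest V) : PartialOrder V :=
  have : IsStrictOrder V F.IsAncestor := { irrefl := F.acyclic, trans := fun _ _ _ => .trans }
  partialOrderOfSO F.IsAncestor

theorem isForestOrder_ancestorOrder [Finite V] (F : RootedForest V) :
    letI := F.ancestorOrder; IsForestOrder V F.depth := by
  let := F.ancestorOrder
  refine ⟨fun w u hu v hv huv => ?_, fun v => ?_⟩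
  · rcases hu with rfl | hu
    · exact Or.inr hv
    · rcases hv with rfl | hv
      · exact Or.inl (Or.inr hu)
      · exact ((F.isAncestor_total hu hv).resolve_left huv).imp Or.inr Or.inr
  · rw [← (Set.toFinite _).cast_ncard_eq, Nat.cast_le]
    exact le_ciSup (f := F.depthOf) (Set.finite_range _).bddAbove v

theorem exists_isAncestor_iff_lt [Finite V] [PartialOrder V]
    (hchain : ∀ v : V, IsChain (· ≤ ·) (Set.Iic v)) :
    ∃ F : RootedForest V, ∀ u v, F.IsAncestor u v ↔ u < v := by
  classical
  have := Fintype.ofFinite V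
  let : LocallyFiniteOrder V := Fintype.toLocallyFiniteOrder
  have covBy_unique {u u' v : V} (hu : u ⋖ v) (hu' : u' ⋖ v) : u = u' := by
    rcases (hchain v).total hu.le hu'.le with h | h
    · exact h.eq_of_not_lt fun huu' => hu.2 huu' hu'.lt
    · exact (h.eq_of_not_lt fun hu'u => hu'.2 hu'u hu.lt).symm
  let parent (v : V) : Option V := if h : ∃ u, u ⋖ v then some h.choose else none
  have parent_eq_some (u v : V) : parent v = some u ↔ u ⋖ v := by
    by_cases h : ∃ u, u ⋖ v
    · simp only [parent, dif_pos h, Option.some.injEq]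
      exact ⟨fun hu => hu ▸ h.choose_spec, covBy_unique h.choose_spec⟩
    · simpa [parent, dif_neg h] using not_exists.1 h u
  have transGen_iff (u v : V) : Relation.TransGen (fun x y => parent y = some x) u v ↔ u < v := by
    simp only [parent_eq_some]
    exact lt_iff_transGen_covBy.symm
  exact ⟨⟨parent, fun v h => lt_irrefl v ((transGen_iff v v).1 h)⟩, transGen_iff⟩

end RootedForest

section Treedepth

variable {V W : Type} {G : SimpleGraph V} {H : SimpleGraph W} {k : ℕ}

theorem exists_closure_eq_comparabilityGraph [Finite V] [PartialOrder V]
    (hV : IsForestOrder V k) :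
    ∃ F : RootedForest V, F.closure = comparabilityGraph V ∧ F.depth ≤ k := by
  obtain ⟨F, hF⟩ := RootedForest.exists_isAncestor_iff_lt hV.isChain_Iic
  refine ⟨F, ?_, ciSup_le' fun v => ?_⟩
  · ext u v
    simp only [RootedForest.closure, comparabilityGraph, hF]
  · have hIic : {u | u = v ∨ F.IsAncestor u v} = Set.Iic v := by
      simp only [hF, ← le_iff_eq_or_lt, Set.Iic_def]
    rw [RootedForest.depthOf, hIic, ← Nat.cast_le (α := ℕ∞), (Set.toFinite _).cast_ncard_eq]
    exact hV.encard_Iic_le v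

theorem exists_le_closure_depth_eq_treedepth [Finite V] (G : SimpleGraph V) :
    ∃ F : RootedForest V, G ≤ F.closure ∧ F.depth = treedepth G := by
  let e := Finite.equivFin V
  let : LinearOrder V := LinearOrder.lift' e e.injective
  obtain ⟨F, hF, -⟩ := exists_closure_eq_comparabilityGraph (isForestOrder_natCard V)
  exact Nat.sInf_mem (s := {n | ∃ F : RootedForest V, G ≤ F.closure ∧ F.depth = n})
    ⟨F.depth, F, hF ▸ fun u v huv => lt_or_gt_of_ne huv.ne, rfl⟩

theorem treedepth_le_iff [Finite V] :
    treedepth G ≤ k ↔ ∃ _ : PartialOrder V, IsForestOrder V k ∧ G ≤ comparabilityGraph V := by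
  constructor
  · intro h
    obtain ⟨F, hGF, hF⟩ := exists_le_closure_depth_eq_treedepth G
    let := F.ancestorOrder
    have hforest : IsForestOrder V F.depth := F.isForestOrder_ancestorOrder
    refine ⟨inferInstance, ⟨hforest.isChain_Iic, fun v => (hforest.encard_Iic_le v).trans
      (Nat.cast_le.2 (hF.trans_le h))⟩, hGF⟩
  · rintro ⟨_, hV, hG⟩
    obtain ⟨F, hF, hdepth⟩ := exists_closure_eq_comparabilityGraph hV
    calc treedepth G ≤ F.depth := Nat.sInf_le ⟨F, hG.trans hF.ge, rfl⟩
      _ ≤ k := hdepth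

theorem IsForestOrder.treedepth_le [Finite V] {W : Type*} [PartialOrder W]
    (hW : IsForestOrder W k) (hG : G.IsContained (comparabilityGraph W)) : treedepth G ≤ k := by
  obtain ⟨f⟩ := hG
  let : PartialOrder V := PartialOrder.lift f f.injective
  exact treedepth_le_iff.2 ⟨inferInstance, hW.of_orderEmbedding ⟨⟨f, f.injective⟩, Iff.rfl⟩,
    fun _ _ huv => f.toHom.map_adj huv⟩

theorem treedepth_le_of_isContained [Finite V] [Finite W] (h : G.IsContained H) :
    treedepth G ≤ treedepth H := by
  obtain ⟨_, hW, hH⟩ := treedepth_le_iff.1 (le_refl (treedepth H))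
  exact hW.treedepth_le (h.trans (.of_le hH))

theorem treedepth_sum [Finite V] [Finite W] (G : SimpleGraph V) (H : SimpleGraph W) :
    treedepth (G ⊕g H) = max (treedepth G) (treedepth H) := by
  apply le_antisymm
  · obtain ⟨_, hV, hG⟩ := treedepth_le_iff.1 (le_max_left (treedepth G) (treedepth H))
    obtain ⟨_, hW, hH⟩ := treedepth_le_iff.1 (le_max_right (treedepth G) (treedepth H))
    refine treedepth_le_iff.2 ⟨inferInstance, hV.sum hW, ?_⟩
    rintro (a | a) (b | b) h
    · exact (hG h).imp Sum.inl_lt_inl_iff.2 Sum.inl_lt_inl_iff.2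
    · exact (SimpleGraph.not_adj_sum_inl_inr a b h).elim
    · exact (SimpleGraph.not_adj_sum_inl_inr b a h.symm).elim
    · exact (hH h).imp Sum.inr_lt_inr_iff.2 Sum.inr_lt_inr_iff.2
  · exact max_le (treedepth_le_of_isContained SimpleGraph.Embedding.sumInl.isContained)
      (treedepth_le_of_isContained SimpleGraph.Embedding.sumInr.isContained)

theorem exists_encard_neighborSet_lt_treedepth [Finite V] [Nonempty V] (G : SimpleGraph V) :
    ∃ v, (G.neighborSet v).encard < treedepth G := by
  obtain ⟨_, hV, hG⟩ := treedepth_le_iff.1 (le_refl (treedepth G))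
  obtain ⟨v, hv⟩ := Set.finite_univ.exists_maximal (Set.univ_nonempty (α := V))
  have hlower : G.neighborSet v ⊂ Set.Iic v := by
    refine Set.ssubset_iff_exists.2 ⟨fun w hw => ?_, v, le_refl v, G.irrefl⟩
    exact ((hG hw).resolve_left fun hvw => hv.not_gt (Set.mem_univ w) hvw).le
  exact ⟨v, (Set.toFinite _).encard_lt_encard hlower |>.trans_le (hV.encard_Iic_le v)⟩

end Treedepth

/-! ### Branching a partial order -/

/-- The tree of partial labellings of `V`: an element consists of `base : V` together with a label
in `ι` for every element of `V` up to `base`. It turns each `v : V` into as many copies as there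
are labellings of `Set.Iic v`. -/
structure Branching (V ι : Type*) [PartialOrder V] where
  base : V
  label : Set.Iic base → ι

namespace Branching

variable {V ι : Type*} [PartialOrder V]

instance : PartialOrder (Branching V ι) where
  le x y := ∃ h : x.base ≤ y.base, ∀ u : Set.Iic x.base, x.label u = y.label ⟨u, u.2.trans h⟩
  le_refl _ := ⟨le_rfl, fun _ => rfl⟩
  le_trans _ _ _ h h' := ⟨h.1.trans h'.1, fun _ => (h.2 _).trans (h'.2 _)⟩
  le_antisymm := by
    rintro ⟨v, f⟩ ⟨w, g⟩ ⟨hvw, hfg⟩ ⟨hwv, -⟩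
    obtain rfl : v = w := hvw.antisymm hwv
    obtain rfl : f = g := funext hfg
    rfl

instance [Finite V] [Finite ι] : Finite (Branching V ι) :=
  Finite.of_injective (fun x => (⟨x.base, x.label⟩ : Σ v : V, Set.Iic v → ι)) fun
    | ⟨_, _⟩, ⟨_, _⟩, rfl => rfl

/-- The copy of `v` labelled by the restriction of `f`. -/
def copy (f : V → ι) (v : V) : Branching V ι := ⟨v, fun u => f u⟩

theorem exists_copy_eq [Nonempty ι] (x : Branching V ι) : ∃ f, copy f x.base = x := by
  classical
  obtain ⟨v, f⟩ := x
  refine ⟨fun u => if h : u ≤ v then f ⟨u, h⟩ else Classical.arbitrary ι, ?_⟩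
  simp only [copy, mk.injEq, heq_eq_eq, true_and]
  exact funext fun u => dif_pos u.2

theorem copy_le_copy_iff {f g : V → ι} {v w : V} :
    copy f v ≤ copy g w ↔ v ≤ w ∧ Set.EqOn f g (Set.Iic v) :=
  ⟨fun ⟨h, hfg⟩ => ⟨h, fun u hu => hfg ⟨u, hu⟩⟩, fun ⟨h, hfg⟩ => ⟨h, fun u => hfg u.2⟩⟩

theorem copy_congr {f g : V → ι} {v : V} (h : Set.EqOn f g (Set.Iic v)) : copy f v = copy g v :=
  le_antisymm (copy_le_copy_iff.2 ⟨le_rfl, h⟩) (copy_le_copy_iff.2 ⟨le_rfl, h.symm⟩)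

theorem copy_update_of_lt [DecidableEq V] (f : V → ι) {v w : V} (h : v < w) (i : ι) :
    copy (Function.update f w i) v = copy f v :=
  copy_congr fun u (hu : u ≤ v) => Function.update_of_ne (hu.trans_lt h).ne i f

theorem base_injOn_Iic (x : Branching V ι) : Set.InjOn base (Set.Iic x) := by
  rintro ⟨v, f⟩ ⟨_, hf⟩ ⟨w, g⟩ ⟨_, hg⟩ (rfl : v = w)
  obtain rfl : f = g := funext fun u => (hf u).trans (hg u).symm
  rfl

theorem copy_strictMono (f : V → ι) : StrictMono (copy f) := fun _ _ h =>
  lt_of_le_of_ne (copy_le_copy_iff.2 ⟨h.le, fun _ _ => rfl⟩) fun he => h.ne (congrArg base he)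

theorem le_copy_iff [Nonempty ι] {f : V → ι} {v : V} {x : Branching V ι} :
    x ≤ copy f v ↔ x.base ≤ v ∧ copy f x.base = x := by
  obtain ⟨g, hg⟩ := exists_copy_eq x
  refine ⟨fun h => ⟨h.1, ?_⟩, fun ⟨h, he⟩ => he ▸ (copy_strictMono f).monotone h⟩
  rw [← hg] at h
  rw [← copy_congr (copy_le_copy_iff.1 h).2, hg]

theorem Iic_copy [Nonempty ι] (f : V → ι) (v : V) : Set.Iic (copy f v) = copy f '' Set.Iic v := by
  ext x
  simp only [Set.mem_Iic, le_copy_iff, Set.mem_image]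
  exact ⟨fun h => ⟨x.base, h⟩, fun ⟨u, hu, hx⟩ => hx ▸ ⟨hu, rfl⟩⟩

end Branching

theorem IsForestOrder.branching {V ι : Type*} [PartialOrder V] [Nonempty ι] {k : ℕ}
    (hV : IsForestOrder V k) : IsForestOrder (Branching V ι) k := by
  constructor <;> intro x <;> obtain ⟨f, hf⟩ := x.exists_copy_eq <;> rw [← hf, Branching.Iic_copy]
  · exact (hV.isChain_Iic x.base).image_of_map_rel _ _ _ fun _ _ h =>
      (Branching.copy_strictMono f).monotone h
  · exact (Set.encard_image_le _ _).trans (hV.encard_Iic_le x.base)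


/-! ### Lower bound -/

section LowerBound

variable {X α : Type*} {H : SimpleGraph X}

/-- A finite set of vertices that is independent in `H` and on which the colours are distinct. -/
structure IsRainbow (H : SimpleGraph X) (C : X → α) (A : Finset X) : Prop where
  isIndepSet : H.IsIndepSet (A : Set X)
  injOn : Set.InjOn C (A : Set X)

theorem IsRainbow.insert [DecidableEq X] {C : X → α} {A : Finset X} {w : X} (hA : IsRainbow H C A)
    (hw : ∀ a ∈ A, ¬ H.Adj a w) (hC : ∀ a ∈ A, C a ≠ C w) : IsRainbow H C (insert w A) := by
  constructor <;> rw [Finset.coe_insert]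
  · exact hA.isIndepSet.insert fun a ha _ => ⟨fun h => hw a ha h.symm, hw a ha⟩
  · exact fun
      | _, .inl rfl, _, .inl rfl, _ => rfl
      | _, .inl rfl, b, .inr hb, hab => (hC b hb hab.symm).elim
      | a, .inr ha, _, .inl rfl, hab => (hC a ha hab).elim
      | _, .inr ha, _, .inr hb, hab => hA.injOn ha hb hab

theorem IsRainbow.subset {C : X → α} {A B : Finset X} (hA : IsRainbow H C A) (hBA : B ⊆ A) :
    IsRainbow H C B :=
  ⟨hA.isIndepSet.mono (Finset.coe_subset.2 hBA), hA.injOn.mono (Finset.coe_subset.2 hBA)⟩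

variable [PartialOrder X]

/-- The subgraph of `H` obtained by deleting every edge whose ends have a common neighbour below
both of them. It is triangle-free as soon as adjacent vertices of `H` are comparable. -/
def lowerTriangleFree (H : SimpleGraph X) : SimpleGraph X where
  Adj x y := H.Adj x y ∧ ∀ z, z < x → z < y → ¬(H.Adj z x ∧ H.Adj z y)
  symm := ⟨fun _ _ h => ⟨h.1.symm, fun z hx hy hz => h.2 z hy hx hz.symm⟩⟩
  loopless := ⟨fun _ h => H.irrefl h.1⟩

theorem lowerTriangleFree_le : lowerTriangleFree H ≤ H := fun _ _ h => h.1

theorem cliqueFree_three_lowerTriangleFree (hH : H ≤ comparabilityGraph X) :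
    (lowerTriangleFree H).CliqueFree 3 := by
  refine cliqueFree_three_iff.2 fun a b c hab hbc hac => ?_
  -- The least vertex of a triangle would be a common lower neighbour of the other two.
  have not_lower {x y z : X} (hxy : (lowerTriangleFree H).Adj x y)
      (hxz : (lowerTriangleFree H).Adj x z) (hyz : (lowerTriangleFree H).Adj y z) :
      ¬(x < y ∧ x < z) := fun h => hyz.2 x h.1 h.2 ⟨hxy.1, hxz.1⟩
  have ha := not_lower hab hac hbc
  have hb := not_lower hab.symm hbc hac
  have hc := not_lower hac.symm hbc.symm hab
  rcases hH hab.1 with hab | hba <;> rcases hH hbc.1 with hbc | hcb <;>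
    rcases hH hac.1 with hac | hca
  all_goals grind [lt_trans]

/-- Every vertex `x` of level less than `k - 1` and every set `D` of vertices up to `x` have a
vertex of the next level above `x` whose neighbours up to `x` are the elements of `D`. -/
def IsSaturated (H : SimpleGraph X) (level : X → ℕ) (k : ℕ) : Prop :=
  ∀ x, level x + 1 < k → ∀ D ⊆ Set.Iic x,
    ∃ w, x < w ∧ level w = level x + 1 ∧ ∀ u ≤ x, H.Adj u w ↔ u ∈ D

variable {C : (lowerTriangleFree H).Coloring α} {level : X → ℕ} {k : ℕ} {x : X} {A B : Finset X}

theorem IsSaturated.exists_color_notMem [DecidableEq X] (hH : IsSaturated H level k)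
    (hx : level x + 1 < k) (hAx : ∀ a ∈ A, a ≤ x) (hBx : ∀ b ∈ B, b ≤ x)
    (hB : H.IsIndepSet (B : Set X)) :
    ∃ w, x < w ∧ level w = level x + 1 ∧ (∀ a ∈ A, ¬ H.Adj a w) ∧ ∀ b ∈ B \ A, C b ≠ C w := by
  obtain ⟨w, hxw, hlevel, hw⟩ := hH x hx {b | b ∈ B \ A} fun b hb =>
    hBx b (Finset.sdiff_subset hb)
  refine ⟨w, hxw, hlevel, fun a ha h => ?_, fun b hb => C.valid ⟨?_, fun z hzb _ ⟨hadj, hzw⟩ => ?_⟩⟩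
  · exact (Finset.mem_sdiff.1 ((hw a (hAx a ha)).1 h)).2 ha
  · exact (hw b (hBx b (Finset.sdiff_subset hb))).2 hb
  · have hz : z ∈ B \ A := (hw z (hzb.le.trans (hBx b (Finset.sdiff_subset hb)))).1 hzw
    exact hB (Finset.sdiff_subset hz) (Finset.sdiff_subset hb) hzb.ne hadj

theorem IsSaturated.exists_isRainbow_insert [DecidableEq X] [DecidableEq α]
    (hH : IsSaturated H level k) (hx : level x + 1 < k)
    (hA : IsRainbow H C A) (hB : IsRainbow H C B) (hAx : ∀ a ∈ A, a ≤ x) (hBx : ∀ b ∈ B, b ≤ x)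
    (hAB : A.image C = B.image C) :
    ∃ w, x < w ∧ level w = level x + 1 ∧ (IsRainbow H C (insert w A) ∨
      ∃ y ∈ A ∩ B, IsRainbow H C (insert w (A.erase y)) ∧ C w = C y) := by
  obtain ⟨w, hxw, hlevel, hwA, hwB⟩ := hH.exists_color_notMem hx hAx hBx hB.isIndepSet
  refine ⟨w, hxw, hlevel, ?_⟩
  by_cases! hwC : ∀ a ∈ A, C a ≠ C w
  · exact .inl (hA.insert hwA hwC)
  obtain ⟨y, hyA, hyw⟩ := hwC
  obtain ⟨b, hbB, hby⟩ := Finset.mem_image.1 (hAB ▸ Finset.mem_image_of_mem C hyA)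
  have hbA : b ∈ A := by_contra fun hbA =>
    hwB b (Finset.mem_sdiff.2 ⟨hbB, hbA⟩) (hby.trans hyw)
  have hyB : y ∈ B := hA.injOn hbA hyA hby ▸ hbB
  refine .inr ⟨y, Finset.mem_inter.2 ⟨hyA, hyB⟩, ?_, hyw.symm⟩
  refine (hA.subset (A.erase_subset y)).insert (fun a ha => hwA a (Finset.mem_of_mem_erase ha)) ?_
  exact fun a ha haw =>
    Finset.ne_of_mem_erase ha (hA.injOn (Finset.mem_of_mem_erase ha) hyA (haw.trans hyw.symm))

/- A new vertex `w` whose neighbours are the elements of `B \ A` either has a new colour or the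
colour of some `y ∈ A ∩ B`. In the latter case replacing `y` by `w` in `A` preserves the colours of
`A` and shrinks `A ∩ B`, so that the former case occurs after at most `|A ∩ B| + 1` rounds. -/
theorem IsSaturated.exists_isRainbow_card_succ [DecidableEq X] [DecidableEq α]
    (hH : IsSaturated H level k)
    (hA : IsRainbow H C A) (hB : IsRainbow H C B) (hAx : ∀ a ∈ A, a ≤ x) (hBx : ∀ b ∈ B, b ≤ x)
    (hAB : A.image C = B.image C) (hx : level x + (A ∩ B).card + 1 < k) :
    ∃ x' A', level x' ≤ level x + (A ∩ B).card + 1 ∧ IsRainbow H C A' ∧ (∀ a ∈ A', a ≤ x') ∧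
      A'.card = B.card + 1 := by
  induction hn : (A ∩ B).card using Nat.strong_induction_on generalizing x A with
  | _ n ih =>
  obtain ⟨w, hxw, hlevel, hw⟩ := hH.exists_isRainbow_insert (by lia) hA hB hAx hBx hAB
  have notMem_of_le {S : Finset X} (hS : ∀ s ∈ S, s ≤ x) : w ∉ S := fun h => (hS w h).not_gt hxw
  have insert_le {S : Finset X} (hS : S ⊆ A) : ∀ s ∈ insert w S, s ≤ w :=
    Finset.forall_mem_insert _ _ _ |>.2 ⟨le_rfl, fun s hs => (hAx s (hS hs)).trans hxw.le⟩
  rcases hw with hw | ⟨y, hy, hw, hwy⟩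
  · refine ⟨w, insert w A, by lia, hw, insert_le subset_rfl, ?_⟩
    rw [Finset.card_insert_of_notMem (notMem_of_le hAx), ← Finset.card_image_of_injOn hA.injOn,
      hAB, Finset.card_image_of_injOn hB.injOn]
  · have hyA : y ∈ A := (Finset.mem_inter.1 hy).1
    have hinter : (insert w (A.erase y) ∩ B).card < (A ∩ B).card := by
      rw [Finset.insert_inter_of_notMem (notMem_of_le hBx), Finset.erase_inter]
      exact Finset.card_erase_lt_of_mem hy
    have himage : (insert w (A.erase y)).image C = B.image C := by
      rw [Finset.image_insert, hwy, ← Finset.image_insert, Finset.insert_erase hyA, hAB]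
    obtain ⟨x', A', hlevel', hA'⟩ := ih _ (hn ▸ hinter) hw (insert_le (A.erase_subset y))
      (fun b hb => (hBx b hb).trans hxw.le) himage (by lia) rfl
    exact ⟨x', A', by lia, hA'⟩

theorem IsSaturated.exists_isRainbow (hH : IsSaturated H level k) {x₀ : X} (hx₀ : level x₀ = 0)
    {l : ℕ} (hl : (l + 1) * (l + 2) ≤ 2 * k) :
    ∃ x A, 2 * (level x + 1) ≤ (l + 1) * (l + 2) ∧ IsRainbow H C A ∧ (∀ a ∈ A, a ≤ x) ∧
      A.card = l + 1 := by
  classical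
  induction l with
  | zero => exact ⟨x₀, {x₀}, by lia, ⟨by simp, by simp⟩, by simp, by simp⟩
  | succ l ih =>
    obtain ⟨x, A, hx, hA, hAx, hcard⟩ := ih (by nlinarith)
    have hinter : (A ∩ A).card = l + 1 := by rw [Finset.inter_self, hcard]
    obtain ⟨x', A', hx', hA', hAx', hcard'⟩ := hH.exists_isRainbow_card_succ hA hA hAx hAx rfl
      (by rw [hinter]; nlinarith)
    rw [hinter] at hx'
    exact ⟨x', A', by nlinarith, hA', hAx', by lia⟩

theorem IsSaturated.le_of_colorable (hH : IsSaturated H level k) {x₀ : X} (hx₀ : level x₀ = 0)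
    {l m : ℕ} (hl : l * (l + 1) ≤ 2 * k) (hm : (lowerTriangleFree H).Colorable m) : l ≤ m := by
  obtain _ | l := l
  · exact zero_le
  classical
  obtain ⟨C⟩ := hm
  obtain ⟨-, A, -, hA, -, hcard⟩ := hH.exists_isRainbow (C := C) hx₀ hl
  calc l + 1 = (A.image C).card := by rw [Finset.card_image_of_injOn hA.injOn, hcard]
    _ ≤ m := card_finset_fin_le _

end LowerBound

/-- The graph on `Branching V (Set V)` in which the last label of a vertex lists the bases of its
lower neighbours. -/
def labelGraph (V : Type*) [PartialOrder V] : SimpleGraph (Branching V (Set V)) where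
  Adj x y := x < y ∧ x.base ∈ y.label ⟨y.base, Set.self_mem_Iic⟩ ∨
    y < x ∧ y.base ∈ x.label ⟨x.base, Set.self_mem_Iic⟩
  symm := ⟨fun _ _ h => h.symm⟩
  loopless := ⟨fun _ h => h.elim (fun h => h.1.false) fun h => h.1.false⟩

theorem labelGraph_le_comparabilityGraph {V : Type*} [PartialOrder V] :
    labelGraph V ≤ comparabilityGraph (Branching V (Set V)) :=
  fun _ _ h => h.imp And.left And.left

theorem isSaturated_labelGraph (k : ℕ) :
    IsSaturated (labelGraph (Fin k)) (fun x => x.base) k := by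
  classical
  intro x hx D hD
  obtain ⟨f, hf⟩ := x.exists_copy_eq
  let j : Fin k := ⟨x.base + 1, hx⟩
  have hj : x.base < j := Fin.lt_def.2 (Nat.lt_succ_self _)
  let w := Branching.copy (Function.update f j (Branching.base '' D)) j
  have hxw : x < w := by
    have hx : Branching.copy (Function.update f j (Branching.base '' D)) x.base = x :=
      (Branching.copy_update_of_lt f hj _).trans hf
    exact hx.symm.trans_lt (Branching.copy_strictMono _ hj)
  refine ⟨w, hxw, rfl, fun u hu => ?_⟩
  have hlabel : w.label ⟨w.base, Set.self_mem_Iic⟩ = Branching.base '' D :=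
    Function.update_self j _ f
  rw [labelGraph]
  simp only [hlabel, hu.trans_lt hxw, true_and, (hu.trans_lt hxw).not_gt, false_and, or_false]
  refine ⟨fun ⟨v, hv, hvu⟩ => ?_, Set.mem_image_of_mem _⟩
  rwa [← Branching.base_injOn_Iic x (hD hv) hu hvu]

theorem le_of_colorable_lowerTriangleFree_labelGraph {k l m : ℕ} (hl : l * (l + 1) ≤ 2 * k)
    (hm : (lowerTriangleFree (labelGraph (Fin k))).Colorable m) : l ≤ m := by
  obtain _ | k := k
  · lia
  · exact (isSaturated_labelGraph _).le_of_colorable (x₀ := Branching.copy (fun _ => ∅) 0) rfl hl hm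

/-! ### Upper bound -/

section FirstFit

variable {V : Type*} [PartialOrder V]

/-- The first-fit colouring along a partial order: every vertex receives the least colour that does
not occur on its lower neighbours. -/
noncomputable def firstFit [WellFoundedLT V] (G : SimpleGraph V) (v : V) : ℕ :=
  sInf {n | ∀ u, ∀ _ : u < v, G.Adj u v → firstFit G u ≠ n}
termination_by wellFounded_lt.wrap v

variable {G : SimpleGraph V}

theorem firstFit_ne [Finite V] {u v : V} (huv : u < v) (h : G.Adj u v) :
    firstFit G u ≠ firstFit G v := by
  have hne : {n | ∀ u, ∀ _ : u < v, G.Adj u v → firstFit G u ≠ n}.Nonempty := by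
    obtain ⟨n, hn⟩ := (Set.finite_range (firstFit G)).exists_notMem
    exact ⟨n, fun u _ _ hu => hn ⟨u, hu⟩⟩
  rw [firstFit.eq_def G v]
  exact Nat.sInf_mem hne u huv h

section WellFounded

variable [WellFoundedLT V]

theorem exists_firstFit_eq {v : V} {n : ℕ} (hn : n < firstFit G v) :
    ∃ u < v, G.Adj u v ∧ firstFit G u = n := by
  rw [firstFit.eq_def] at hn
  simpa using Nat.notMem_of_lt_sInf hn

theorem firstFit_le_encard (v : V) : (firstFit G v : ℕ∞) ≤ {u | u < v ∧ G.Adj u v}.encard :=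
  calc (firstFit G v : ℕ∞) = (Set.Iio (firstFit G v)).encard := by
        rw [← Finset.coe_Iio, Set.encard_coe_eq_coe_finsetCard, Nat.card_Iio]
    _ ≤ (firstFit G '' {u | u < v ∧ G.Adj u v}).encard := Set.encard_le_encard fun n hn => by
        obtain ⟨u, huv, hadj, hu⟩ := exists_firstFit_eq hn
        exact ⟨u, ⟨huv, hadj⟩, hu⟩
    _ ≤ {u | u < v ∧ G.Adj u v}.encard := Set.encard_image_le _ _

theorem two_mul_firstFit_le (hG : G.CliqueFree 3) (v : V) :
    2 * (firstFit G v : ℕ∞) ≤ (Set.Iic v).encard := by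
  rcases Nat.eq_zero_or_pos (firstFit G v) with h0 | hpos
  · simp [h0]
  obtain ⟨z, hzv, hadj, hz⟩ := exists_firstFit_eq (Nat.sub_one_lt hpos.ne')
  have hdisj : Disjoint {u | u < v ∧ G.Adj u v} {u | u < z ∧ G.Adj u z} :=
    Set.disjoint_left.2 fun u hv hz => cliqueFree_three_iff.1 hG hz.2 hadj hv.2
  have hlower : {u | u < v ∧ G.Adj u v} ∪ {u | u < z ∧ G.Adj u z} ⊆ Set.Iio v :=
    Set.union_subset (fun u hu => hu.1) fun u hu => hu.1.trans hzv
  calc 2 * (firstFit G v : ℕ∞) = firstFit G v + firstFit G z + 1 := by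
        norm_cast
        lia
    _ ≤ {u | u < v ∧ G.Adj u v}.encard + {u | u < z ∧ G.Adj u z}.encard + 1 := by
        gcongr <;> exact firstFit_le_encard _
    _ ≤ (Set.Iio v).encard + 1 := by
        rw [← Set.encard_union_eq hdisj]
        gcongr
    _ = (Set.Iic v).encard := by
        rw [← Set.encard_insert_of_notMem Set.self_notMem_Iio, Set.Iio_insert]

end WellFounded

theorem IsForestOrder.colorable [Finite V] {k : ℕ} (hV : IsForestOrder V k)
    (hG : G ≤ comparabilityGraph V) (hfree : G.CliqueFree 3) : G.Colorable (k / 2 + 1) := by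
  have hle (v : V) : 2 * firstFit G v ≤ k := by
    exact_mod_cast (two_mul_firstFit_le hfree v).trans (hV.encard_Iic_le v)
  refine ⟨SimpleGraph.Coloring.mk (fun v => ⟨firstFit G v, by have := hle v; lia⟩) ?_⟩
  intro u v h huv
  rcases hG h with hlt | hlt
  · exact firstFit_ne hlt h (congrArg Fin.val huv)
  · exact firstFit_ne hlt h.symm (congrArg Fin.val huv).symm

end FirstFit

/-! ### From defective to proper colourings -/

section Defect

variable {V W : Type} {G : SimpleGraph V} {H : SimpleGraph W} {m d : ℕ}

theorem hasDefect_iff {col : V → Fin m} :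
    HasDefect G col d ↔ ∀ v, {w | G.Adj v w ∧ col w = col v}.ncard ≤ d := by
  have image_neighborSet (i : Fin m) (C : MonoComponent G col i) (v : C) :
      (fun w : C => w.1.1) '' C.toSimpleGraph.neighborSet v =
        {w | G.Adj v.1.1 w ∧ col w = col v.1.1} := by
    ext w
    constructor
    · rintro ⟨w, hw, rfl⟩
      exact ⟨hw, w.1.2.trans v.1.2.symm⟩
    · rintro ⟨hw, hc⟩
      have hadj : (G.induce {v | col v = i}).Adj v.1 ⟨w, hc.trans v.1.2⟩ := hw
      exact ⟨⟨⟨w, hc.trans v.1.2⟩, C.mem_supp_of_adj_mem_supp v.2 hadj⟩, hw, rfl⟩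
  have ncard_neighborSet (i : Fin m) (C : MonoComponent G col i) (v : C) :
      (C.toSimpleGraph.neighborSet v).ncard = {w | G.Adj v.1.1 w ∧ col w = col v.1.1}.ncard := by
    rw [← image_neighborSet]
    exact (Set.ncard_image_of_injective _
      (Subtype.val_injective.comp Subtype.val_injective)).symm
  simp only [HasDefect, ncard_neighborSet]
  exact ⟨fun h v => h (col v) (SimpleGraph.connectedComponentMk _ ⟨v, rfl⟩) ⟨⟨v, rfl⟩, rfl⟩,
    fun h i C v => h v.1.1⟩

theorem HasDefect.comp_copy [Finite W] {col : W → Fin m} (h : HasDefect H col d) (f : G.Copy H) :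
    HasDefect G (col ∘ f) d := by
  rw [hasDefect_iff] at h ⊢
  intro v
  rw [← Set.ncard_image_of_injective _ f.injective]
  refine (Set.ncard_le_ncard ?_ (Set.toFinite _)).trans (h (f v))
  rintro _ ⟨w, ⟨hw, hc⟩, rfl⟩
  exact ⟨f.toHom.map_adj hw, hc⟩

end Defect

section BlowUp

/-- The blow-up of `G` along a partial order: two copies are adjacent if one lies below the other
and their bases are adjacent in `G`. The many copies of a vertex above a fixed copy of a lower
neighbour cannot all receive the colour of the latter in a colouring of bounded defect. -/
def blowUp {V : Type*} [PartialOrder V] (G : SimpleGraph V) (ι : Type*) :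
    SimpleGraph (Branching V ι) :=
  G.comap Branching.base ⊓ comparabilityGraph (Branching V ι)

theorem cliqueFree_three_blowUp {V ι : Type*} [PartialOrder V] {G : SimpleGraph V}
    (hG : G.CliqueFree 3) : (blowUp G ι).CliqueFree 3 :=
  cliqueFree_three_of_hom ⟨Branching.base, fun h => h.1⟩ hG

theorem Branching.exists_forall_copy {V ι : Type*} [PartialOrder V] [WellFoundedLT V] [Nonempty ι]
    {P : Branching V ι → Prop} [DecidableEq V]
    (hP : ∀ f v, ∃ i, P (copy (Function.update f v i) v)) : ∃ f, ∀ v, P (copy f v) := by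
  classical
  choose i hi using hP
  let extend (v : V) (g : ∀ u, u < v → ι) (u : V) : ι :=
    if h : u < v then g u h else Classical.arbitrary ι
  let f : V → ι := wellFounded_lt.fix fun v g => i (extend v g) v
  have hf (v : V) : f v = i (extend v fun u _ => f u) v := wellFounded_lt.fix_eq _ v
  refine ⟨f, fun v => ?_⟩
  have hcopy : copy f v =
      copy (Function.update (extend v fun u _ => f u) v (i (extend v fun u _ => f u) v)) v := by
    refine copy_congr fun u (hu : u ≤ v) => ?_
    rcases hu.eq_or_lt with rfl | huv
    · rw [Function.update_self, hf]
    · rw [Function.update_of_ne huv.ne]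
      simp only [extend, dif_pos huv]
  exact hcopy ▸ hi _ v

variable {V ι : Type} [PartialOrder V] [Finite V] [Finite ι] {G : SimpleGraph V} {m d : ℕ}
  {col : Branching V ι → Fin m}

open Branching

theorem HasDefect.exists_label [DecidableEq V] (h : HasDefect (blowUp G ι) col d)
    (hι : Nat.card V * d < Nat.card ι) (f : V → ι) (v : V) :
    ∃ i, ∀ y < copy (Function.update f v i) v,
      (blowUp G ι).Adj y (copy (Function.update f v i) v) →
        col y ≠ col (copy (Function.update f v i) v) := by
  classical
  have := Fintype.ofFinite V
  have := Fintype.ofFinite ι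
  have : Nonempty ι := (Finite.card_pos_iff (α := ι)).1 (by lia)
  by_contra! hbad
  choose y hy hadj hcol using hbad
  have hcopy (i : ι) : copy f (y i).base = y i := by
    obtain ⟨hle, he⟩ := le_copy_iff.1 (hy i).le
    have hne : (y i).base ≠ v := fun hv => (hy i).ne (he ▸ hv ▸ rfl)
    exact (copy_update_of_lt f (hle.lt_of_ne hne) i).symm.trans he
  obtain ⟨x, -, hx⟩ := Finset.exists_lt_card_fiber_of_mul_lt_card_of_maps_to
    (s := Finset.univ) (t := Finset.univ.image (copy f)) (f := y) (n := d)
    (fun i _ => Finset.mem_image.2 ⟨(y i).base, Finset.mem_univ _, hcopy i⟩) (by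
      grw [Finset.card_image_le]
      simpa only [Nat.card_eq_fintype_card, Finset.card_univ] using hι)
  refine hx.not_ge (le_trans ?_ (hasDefect_iff.1 h x))
  rw [← Set.ncard_coe_finset]
  refine Set.ncard_le_ncard_of_injOn (fun i => copy (Function.update f v i) v)
    (fun i hi => ?_) (fun i _ j _ hij => ?_) (Set.toFinite _)
  · obtain rfl := (Finset.mem_filter.1 (Finset.mem_coe.1 hi)).2
    exact ⟨hadj i, (hcol i).symm⟩
  · simpa using (copy_le_copy_iff.1 hij.le).2 (Set.self_mem_Iic (a := v))

theorem HasDefect.colorable_of_blowUp (h : HasDefect (blowUp G ι) col d)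
    (hG : G ≤ comparabilityGraph V) (hι : Nat.card V * d < Nat.card ι) : G.Colorable m := by
  classical
  have : Nonempty ι := (Finite.card_pos_iff (α := ι)).1 (by lia)
  obtain ⟨f, hf⟩ := exists_forall_copy
    (P := fun x => ∀ y < x, (blowUp G ι).Adj y x → col y ≠ col x) (h.exists_label hι)
  have ne_of_lt {u v : V} (huv : u < v) (hadj : G.Adj u v) : col (copy f u) ≠ col (copy f v) :=
    hf v _ (copy_strictMono f huv) ⟨hadj, .inl (copy_strictMono f huv)⟩
  refine ⟨SimpleGraph.Coloring.mk (fun v => col (copy f v)) fun {u v} hadj => ?_⟩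
  exact (hG hadj).elim (ne_of_lt · hadj) fun hvu => (ne_of_lt hvu hadj.symm).symm

end BlowUp

/-! ### Attaining a prescribed treedepth -/

section CompleteBipartite

theorem cliqueFree_three_completeBipartiteGraph (V W : Type*) :
    (completeBipartiteGraph V W).CliqueFree 3 :=
  cliqueFree_three_iff.2 fun a b c hab hbc hac => by
    rcases a with a | a <;> rcases b with b | b <;> rcases c with c | c <;> simp_all

theorem encard_neighborSet_completeBipartiteGraph {V W : Type*} (v : V ⊕ W) :
    ((completeBipartiteGraph V W).neighborSet v).encard =
      v.elim (fun _ => ENat.card W) fun _ => ENat.card V := by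
  rcases v with v | w
  · have : (completeBipartiteGraph V W).neighborSet (.inl v) = Set.range Sum.inr := by
      ext (u | u) <;> simp
    rw [this, ← Set.image_univ, Sum.inr_injective.encard_image, Set.encard_univ, Sum.elim_inl]
  · have : (completeBipartiteGraph V W).neighborSet (.inr w) = Set.range Sum.inl := by
      ext (u | u) <;> simp
    rw [this, ← Set.image_univ, Sum.inl_injective.encard_image, Set.encard_univ, Sum.elim_inr]

open Branching in
theorem completeBipartiteGraph_isContained_comparabilityGraph (n : ℕ) (W : Type*) [Nonempty W] :
    (completeBipartiteGraph (Fin n) W).IsContained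
      (comparabilityGraph (Branching (Fin (n + 1)) W)) := by
  let g (w : W) : Fin (n + 1) → W := Function.update (fun _ => Classical.arbitrary W) (Fin.last n) w
  let f : Fin n ⊕ W → Branching (Fin (n + 1)) W :=
    Sum.elim (fun i => copy (fun _ => Classical.arbitrary W) i.castSucc)
      fun w => copy (g w) (Fin.last n)
  have hlt (i : Fin n) (w : W) : f (.inl i) < f (.inr w) := by
    have hi : copy (g w) i.castSucc = f (.inl i) := copy_update_of_lt _ i.castSucc_lt_last w
    exact hi.symm.trans_lt (copy_strictMono (g w) i.castSucc_lt_last)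
  have hinj : f.Injective := by
    rintro (i | w) (j | w') h
    · rw [Fin.castSucc_injective n (congrArg base h)]
    · exact ((hlt i w').ne h).elim
    · exact ((hlt j w).ne' h).elim
    · have := (copy_le_copy_iff.1 h.le).2 (Set.self_mem_Iic (a := Fin.last n))
      simpa [g] using this
  refine ⟨⟨⟨f, fun {u v} h => ?_⟩, hinj⟩⟩
  rcases u with i | w <;> rcases v with j | w'
  exacts [by simp at h, .inl (hlt i w'), .inr (hlt j w), by simp at h]

theorem treedepth_completeBipartiteGraph (n : ℕ) :
    treedepth (completeBipartiteGraph (Fin n) (Fin (n + 1))) = n + 1 := by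
  apply le_antisymm
  · refine IsForestOrder.treedepth_le ?_
      (completeBipartiteGraph_isContained_comparabilityGraph n (Fin (n + 1)))
    simpa using (isForestOrder_natCard (Fin (n + 1))).branching (ι := Fin (n + 1))
  · obtain ⟨v, hv⟩ := exists_encard_neighborSet_lt_treedepth
      (completeBipartiteGraph (Fin n) (Fin (n + 1)))
    have hn : (n : ℕ∞) ≤ ((completeBipartiteGraph (Fin n) (Fin (n + 1))).neighborSet v).encard := by
      rw [encard_neighborSet_completeBipartiteGraph]
      rcases v with v | v <;> simp
    exact_mod_cast hn.trans_lt hv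

end CompleteBipartite

/-! ### Chromatic numbers of graph classes -/

section Clustering

variable {V : Type} {m c : ℕ} {G : SimpleGraph V}

theorem hasClustering_of_coloring (C : G.Coloring (Fin m)) : HasClustering G C 1 := by
  have induce_eq_bot (i : Fin m) : G.induce {v | C v = i} = ⊥ := by
    ext u v
    simp only [SimpleGraph.bot_adj, iff_false]
    exact fun h => C.valid h (u.2.trans v.2.symm)
  intro i K
  have hK : K.supp.Subsingleton := fun u hu v hv => by
    have h : (G.induce {v | C v = i}).Reachable u v :=
      SimpleGraph.ConnectedComponent.exact (hu.trans hv.symm)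
    rwa [induce_eq_bot, SimpleGraph.reachable_bot] at h
  exact (Set.ncard_le_one hK.finite).2 fun u hu v hv => hK hu hv

theorem HasClustering.hasDefect [Finite V] {col : V → Fin m} (h : HasClustering G col c) :
    HasDefect G col c := by
  intro i K v
  rw [← Set.ncard_image_of_injective _ Subtype.val_injective]
  refine (Set.ncard_le_ncard ?_ (Set.toFinite _)).trans (h i K)
  rintro _ ⟨w, -, rfl⟩
  exact w.2

end Clustering

namespace GraphClass

variable {𝒢 𝓗 : GraphClass}

theorem chromaticNumber_le_iff {m : ℕ} : 𝒢.chromaticNumber ≤ m ↔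
    ∀ (V : Type) [Finite V] (G : SimpleGraph V), 𝒢.Mem G → G.Colorable m := by
  simp only [chromaticNumber, sSup_le_iff]
  constructor
  · exact fun h V _ G hG =>
      SimpleGraph.chromaticNumber_le_iff_colorable.1 (h _ ⟨V, ‹_›, G, hG, rfl⟩)
  · rintro h _ ⟨V, _, G, hG, rfl⟩
    exact SimpleGraph.chromaticNumber_le_iff_colorable.2 (h V G hG)

theorem defectiveChromaticNumber_le_clusteredChromaticNumber :
    𝒢.defectiveChromaticNumber ≤ 𝒢.clusteredChromaticNumber := by
  refine sInf_le_sInf ?_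
  rintro _ ⟨m, rfl, c, h⟩
  exact ⟨m, rfl, c, fun V _ G hG => (h V G hG).imp fun _ => HasClustering.hasDefect⟩

theorem clusteredChromaticNumber_le_chromaticNumber :
    𝒢.clusteredChromaticNumber ≤ 𝒢.chromaticNumber := by
  cases hm : 𝒢.chromaticNumber with
  | top => exact le_top
  | coe m =>
    exact sInf_le ⟨m, rfl, 1, fun V _ G hG => (chromaticNumber_le_iff.1 hm.le V G hG).elim
      fun C => ⟨C, hasClustering_of_coloring C⟩⟩

theorem chromaticNumber_mono
    (h : ∀ {V : Type} [Finite V] {G : SimpleGraph V}, 𝒢.Mem G → 𝓗.Mem G) :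
    𝒢.chromaticNumber ≤ 𝓗.chromaticNumber :=
  sSup_le_sSup fun _ ⟨V, hV, G, hG, hn⟩ => ⟨V, hV, G, h hG, hn⟩

theorem defectiveChromaticNumber_mono
    (h : ∀ {V : Type} [Finite V] {G : SimpleGraph V}, 𝒢.Mem G → 𝓗.Mem G) :
    𝒢.defectiveChromaticNumber ≤ 𝓗.defectiveChromaticNumber :=
  sInf_le_sInf fun _ ⟨m, hn, d, hd⟩ => ⟨m, hn, d, fun V _ G hG => hd V G (h hG)⟩

theorem chromaticNumbers_eq_of_le
    (h : ∀ {V : Type} [Finite V] {G : SimpleGraph V}, 𝒢.Mem G → 𝓗.Mem G)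
    (hle : 𝓗.chromaticNumber ≤ 𝒢.defectiveChromaticNumber) :
    (𝒢.chromaticNumber = 𝓗.chromaticNumber ∧ 𝒢.defectiveChromaticNumber = 𝓗.chromaticNumber ∧
      𝒢.clusteredChromaticNumber = 𝓗.chromaticNumber) ∧
    𝓗.defectiveChromaticNumber = 𝓗.chromaticNumber ∧
      𝓗.clusteredChromaticNumber = 𝓗.chromaticNumber := by
  have hG := 𝒢.defectiveChromaticNumber_le_clusteredChromaticNumber
  have hG' := 𝒢.clusteredChromaticNumber_le_chromaticNumber
  have hH := 𝓗.defectiveChromaticNumber_le_clusteredChromaticNumber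
  have hH' := 𝓗.clusteredChromaticNumber_le_chromaticNumber
  have hchr := chromaticNumber_mono h
  have hdef := defectiveChromaticNumber_mono h
  refine ⟨⟨?_, ?_, ?_⟩, ?_, ?_⟩ <;> order

end GraphClass

section TriangleFreeTreedepth

variable {k : ℕ}

theorem chromaticNumber_triangleFreeTreedepthLE_le (k : ℕ) :
    (triangleFreeTreedepthLE k).chromaticNumber ≤ (k / 2 + 1 : ℕ) :=
  GraphClass.chromaticNumber_le_iff.2 fun _ _ _ hG =>
    have ⟨_, hV, hle⟩ := treedepth_le_iff.1 hG.2
    hV.colorable hle hG.1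

theorem lowerTriangleFree_labelGraph_mem_triangleFreeTreedepthLE (k : ℕ) :
    (triangleFreeTreedepthLE k).Mem (lowerTriangleFree (labelGraph (Fin k))) := by
  have hforest : IsForestOrder (Branching (Fin k) (Set (Fin k))) k := by
    simpa using (isForestOrder_natCard (Fin k)).branching (ι := Set (Fin k))
  exact ⟨cliqueFree_three_lowerTriangleFree labelGraph_le_comparabilityGraph,
    hforest.treedepth_le (.of_le (lowerTriangleFree_le.trans labelGraph_le_comparabilityGraph))⟩

theorem le_of_chromaticNumber_triangleFreeTreedepthLE_le {l m : ℕ}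
    (hm : (triangleFreeTreedepthLE k).chromaticNumber ≤ m) (hl : l * (l + 1) ≤ 2 * k) : l ≤ m :=
  le_of_colorable_lowerTriangleFree_labelGraph hl <| GraphClass.chromaticNumber_le_iff.1 hm _ _ <|
    lowerTriangleFree_labelGraph_mem_triangleFreeTreedepthLE k

theorem exists_isContained_triangleFreeTreedepth (hk : 1 ≤ k) {V : Type} [Finite V]
    {G : SimpleGraph V} (hG : (triangleFreeTreedepthLE k).Mem G) :
    ∃ (W : Type) (_ : Finite W) (H : SimpleGraph W),
      G.IsContained H ∧ (triangleFreeTreedepth k).Mem H := by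
  obtain ⟨n, rfl⟩ : ∃ n, k = n + 1 := ⟨k - 1, by lia⟩
  refine ⟨_, inferInstance, G ⊕g completeBipartiteGraph (Fin n) (Fin (n + 1)),
    SimpleGraph.Embedding.sumInl.isContained,
    cliqueFree_three_sum hG.1 (cliqueFree_three_completeBipartiteGraph _ _), ?_⟩
  rw [treedepth_sum, treedepth_completeBipartiteGraph, max_eq_right hG.2]

theorem blowUp_mem_triangleFreeTreedepthLE {V : Type} [PartialOrder V] [Finite V]
    {G : SimpleGraph V} (hV : IsForestOrder V k) (hG : G.CliqueFree 3) (ι : Type) [Finite ι]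
    [Nonempty ι] : (triangleFreeTreedepthLE k).Mem (blowUp G ι) :=
  ⟨cliqueFree_three_blowUp hG, hV.branching.treedepth_le (.of_le inf_le_right)⟩

theorem chromaticNumber_le_defectiveChromaticNumber_triangleFreeTreedepth (hk : 1 ≤ k) :
    (triangleFreeTreedepthLE k).chromaticNumber ≤
      (triangleFreeTreedepth k).defectiveChromaticNumber := by
  refine le_sInf ?_
  rintro _ ⟨m, rfl, d, hd⟩
  refine GraphClass.chromaticNumber_le_iff.2 fun V _ G hG => ?_
  obtain ⟨_, hV, hle⟩ := treedepth_le_iff.1 hG.2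
  obtain ⟨W, _, H, ⟨f⟩, hH⟩ := exists_isContained_triangleFreeTreedepth hk
    (blowUp_mem_triangleFreeTreedepthLE hV hG.1 (Fin (Nat.card V * d + 1)))
  obtain ⟨col, hcol⟩ := hd W H hH
  exact (hcol.comp_copy f).colorable_of_blowUp hle (by simp)

end TriangleFreeTreedepth

section Asymptotics

theorem tendsto_two_div_sqrt :
    Filter.Tendsto (fun k : ℕ => 2 / Real.sqrt (2 * k)) Filter.atTop (nhds 0) :=
  tendsto_const_nhds.div_atTop (Real.tendsto_sqrt_atTop.comp
    (tendsto_natCast_atTop_atTop.const_mul_atTop two_pos))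

theorem sqrt_sub_two_le_of_forall_le {n c : ℕ} (h : ∀ l, l * (l + 1) ≤ n → l ≤ c) :
    Real.sqrt n - 2 ≤ c := by
  have hl : (n.sqrt - 1) * (n.sqrt - 1 + 1) ≤ n := by
    rcases Nat.eq_zero_or_pos n.sqrt with h0 | hpos
    · simp [h0]
    · rw [Nat.sub_add_cancel hpos]
      exact (Nat.mul_le_mul_right _ (Nat.sub_le _ _)).trans n.sqrt_le
  have hsqrt : (n.sqrt : ℝ) ≤ c + 1 := by exact_mod_cast Nat.sub_le_iff_le_add.1 (h _ hl)
  linarith [Real.real_sqrt_le_nat_sqrt_succ (a := n)]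

theorem div_two_add_one_le_ceil (k : ℕ) : k / 2 + 1 ≤ ⌈((k : ℝ) + 2) / 2⌉₊ := by
  refine Nat.cast_le (α := ℝ).1 (le_trans ?_ (Nat.le_ceil _))
  have : ((k / 2 : ℕ) : ℝ) ≤ (k : ℝ) / 2 := Nat.cast_div_le
  push_cast
  linarith

end Asymptotics

theorem mainTheorem5 :
    ∃ ε : ℕ → ℝ, Filter.Tendsto ε Filter.atTop (nhds 0) ∧
      ∀ k : ℕ, 1 ≤ k → ∃ c : ℕ,
        ((triangleFreeTreedepth k).chromaticNumber = c ∧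
          (triangleFreeTreedepth k).defectiveChromaticNumber = c ∧
          (triangleFreeTreedepth k).clusteredChromaticNumber = c) ∧
        ((triangleFreeTreedepthLE k).chromaticNumber = c ∧
          (triangleFreeTreedepthLE k).defectiveChromaticNumber = c ∧
          (triangleFreeTreedepthLE k).clusteredChromaticNumber = c) ∧
        (1 - ε k) * Real.sqrt (2 * k) ≤ c ∧
        c ≤ ⌈((k : ℝ) + 2) / 2⌉₊ := by
  refine ⟨fun k => 2 / Real.sqrt (2 * k), tendsto_two_div_sqrt, fun k hk => ?_⟩
  have hupper := chromaticNumber_triangleFreeTreedepthLE_le k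
  obtain ⟨c, hc⟩ := ENat.ne_top_iff_exists.1 (ne_top_of_le_ne_top (ENat.natCast_ne_top _) hupper)
  have hLE := chromaticNumber_le_defectiveChromaticNumber_triangleFreeTreedepth hk
  have heq := GraphClass.chromaticNumbers_eq_of_le (𝒢 := triangleFreeTreedepth k)
    (𝓗 := triangleFreeTreedepthLE k) (fun hG => ⟨hG.1, hG.2.le⟩) hLE
  rw [← hc] at heq hupper
  refine ⟨c, heq.1, ⟨hc.symm, heq.2⟩, ?_, ?_⟩
  · have hlower : Real.sqrt (2 * k) - 2 ≤ c := by
      exact_mod_cast sqrt_sub_two_le_of_forall_le fun l =>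
        le_of_chromaticNumber_triangleFreeTreedepthLE_le hc.ge
    have hpos : 0 < Real.sqrt (2 * k) := by positivity
    rwa [sub_mul, div_mul_cancel₀ _ hpos.ne', one_mul]
  · exact (Nat.cast_le.1 hupper).trans (div_two_add_one_le_ceil k)
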